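/- Let $n\ge 3$ and let $P_1,\dots,P_n,F$ be points of the Euclidean plane, no three of which are collinear. Let $\varepsilon_1,\dots,\varepsilon_n$ be independent random variables with values in $(-\pi,\pi]$, and for each $i$ let $R_i$ be the random open ray starting at $P_i$ (with $P_i\notin R_i$) that makes the signed angle $\varepsilon_i$ with the ray from $P_i$ through $F$. Assume that $$\mathrm{Prob}(\varepsilon_i<0)=\mathrm{Prob}(\varepsilon_i>0)=\tfrac12\quad\text{for every } i,$$ and that $$\mathrm{Prob}(R_i\cap R_j=\emptyset)=0\quad\text{for all } i\ne j.$$ Let $L_i$ be the line containing $R_i$, and let $U$ be the (random) union of the unbounded connected components of the complement of $L_1\cup\dots\cup L_n$ in the plane. Then $\{F\in U\}$ is an event and $$\mathrm{Prob}(F\in U)=\frac{2n}{2^n}.$$ -/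

import Mathlib

namespace CockedHat

/-- The direction obtained from that of the ray `P → F` by rotating it by the signed angle `ε`
(counterclockwise for `ε > 0`). The Euclidean plane is `ℂ`. -/
noncomputable def direction (P F : ℂ) (ε : ℝ) : ℂ :=
  Complex.exp (ε * Complex.I) * (F - P)

/-- The ray from `P` that makes the signed angle `ε` with the ray `P → F`.
Its starting point `P` does not belong to it. -/
def ray (P F : ℂ) (ε : ℝ) : Set ℂ :=
  {z | ∃ t : ℝ, 0 < t ∧ z = P + t * direction P F ε}

/-- The line that contains `ray P F ε`. -/
def lineOfRay (P F : ℂ) (ε : ℝ) : Set ℂ :=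
  {z | ∃ t : ℝ, z = P + t * direction P F ε}

/-- The union of the unbounded connected components of the complement of the lines `L i`. -/
def unboundedRegion {ι : Type*} (L : ι → Set ℂ) : Set ℂ :=
  ⋃₀ {C | ∃ x ∈ (⋃ i, L i)ᶜ, C = connectedComponentIn (⋃ i, L i)ᶜ x ∧ ¬ Bornology.IsBounded C}

/-- No three points (with distinct indices) of the family are collinear. -/
def GeneralPosition {ι : Type*} (Q : ι → ℂ) : Prop :=
  ∀ i j k, i ≠ j → i ≠ k → j ≠ k → ¬ Collinear ℝ {Q i, Q j, Q k}

end CockedHat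

/-! Write `d i` for the direction of the `i`-th ray. `F` lies in an unbounded region iff it is on no
line and the reoriented directions `sin (ε i) * d i` fit in a closed half-plane, that is, one of
them comes first counterclockwise (`mem_unboundedRegion_iff`). When two rays meet, the sign of
`cross (d i) (d j)` can be read off from `ε i` alone and also from `ε j` alone. By independence it
is almost surely constant, and it is not zero (`ae_cross_direction_pos_or_neg`). So the relation "`d
j` is to the left of `d i`" is a deterministic tournament. The index that comes first and its sign
then force all other signs, which gives `2n` distinct sign patterns (`signPattern_injective`), each
of probability `1 / 2 ^ n`. -/

open MeasureTheory ProbabilityTheory Filter Topology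

namespace CockedHat

/-! ### Plane geometry: unbounded regions and half-planes of directions. -/

/-- The planar cross product, that is, the signed area of the parallelogram spanned by `a`, `b`. -/
def cross (a b : ℂ) : ℝ := a.re * b.im - a.im * b.re

theorem cross_swap (a b : ℂ) : cross a b = -cross b a := by
  simp only [cross]; ring

theorem cross_self (a : ℂ) : cross a a = 0 := by
  simp only [cross]; ring

/-- The sign of `sin ε` tells on which side of the directed line `F` lies; hence `sin ε` serves as
the reorienting factor throughout. -/
theorem cross_direction_sub (P F : ℂ) (ε : ℝ) :
    cross (direction P F ε) (F - P) = -(Complex.normSq (F - P) * Real.sin ε) := by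
  simp only [cross, direction, Complex.mul_re, Complex.mul_im, Complex.exp_ofReal_mul_I_re,
    Complex.exp_ofReal_mul_I_im, Complex.normSq_apply]
  ring

theorem direction_ne_zero {P F : ℂ} (h : P ≠ F) (ε : ℝ) : direction P F ε ≠ 0 :=
  mul_ne_zero (Complex.exp_ne_zero _) (sub_ne_zero.2 h.symm)

theorem continuous_direction (P F : ℂ) : Continuous (direction P F) := by
  unfold direction
  fun_prop

theorem continuous_cross : Continuous fun p : ℂ × ℂ => cross p.1 p.2 := by
  unfold cross
  fun_prop

theorem exists_eq_mul_of_cross_eq_zero {a b : ℂ} (ha : a ≠ 0) (h : cross a b = 0) :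
    ∃ r : ℝ, b = r * a := by
  have hn : Complex.normSq a ≠ 0 := by simpa using ha
  refine ⟨(a.re * b.re + a.im * b.im) / Complex.normSq a, ?_⟩
  rw [Complex.normSq_apply, ← sq, ← sq] at *
  simp only [cross] at h
  apply Complex.ext
  · simp only [Complex.mul_re, Complex.ofReal_re, Complex.ofReal_im]
    field_simp
    linear_combination (-a.im) * h
  · simp only [Complex.mul_im, Complex.ofReal_re, Complex.ofReal_im]
    field_simp
    linear_combination a.re * h

theorem mem_lineOfRay_iff {P F : ℂ} (h : P ≠ F) (ε : ℝ) (z : ℂ) :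
    z ∈ lineOfRay P F ε ↔ cross (direction P F ε) (z - P) = 0 := by
  constructor
  · rintro ⟨t, rfl⟩
    simp [cross]; ring
  · intro hz
    obtain ⟨r, hr⟩ := exists_eq_mul_of_cross_eq_zero (direction_ne_zero h ε) hz
    exact ⟨r, by rw [← hr]; ring⟩

theorem collinear_of_cross_eq_zero {F A B : ℂ} (h : cross (A - F) (B - F) = 0) :
    Collinear ℝ {F, A, B} := by
  rw [collinear_iff_of_mem (p₀ := F) (by simp)]
  by_cases ha : A - F = 0
  · refine ⟨B - F, ?_⟩
    rintro p (rfl | rfl | rfl)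
    · exact ⟨0, by simp⟩
    · exact ⟨0, by simp [sub_eq_zero.1 ha]⟩
    · exact ⟨1, by simp⟩
  · obtain ⟨r, hr⟩ := exists_eq_mul_of_cross_eq_zero ha h
    refine ⟨A - F, ?_⟩
    rintro p (rfl | rfl | rfl)
    · exact ⟨0, by simp⟩
    · exact ⟨1, by simp⟩
    · exact ⟨r, by simp [← hr]⟩

/-- A finite family of vectors in a closed half-plane has a first one in counterclockwise order. -/
theorem exists_forall_cross_nonneg {ι : Type*} [Finite ι] [Nonempty ι] {e : ι → ℂ} {v : ℂ}
    (hv : v ≠ 0) (h : ∀ i, 0 ≤ cross v (e i)) : ∃ i, ∀ j, 0 ≤ cross (e i) (e j) := by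
  -- Division by `v` moves the half-plane to the upper one, where arguments lie in `[0, π]`; their
  -- differences from the smallest one then have nonnegative sine.
  obtain ⟨i, hi⟩ := Finite.exists_min fun i => (e i / v).arg
  refine ⟨i, fun j => ?_⟩
  have hn : 0 < Complex.normSq v := Complex.normSq_pos.2 hv
  have him : ∀ k, 0 ≤ (e k / v).im := fun k => by
    rw [Complex.div_im]
    have := h k
    simp only [cross] at this
    have h2 : (e k).im * v.re / Complex.normSq v - (e k).re * v.im / Complex.normSq v
      = (v.re * (e k).im - v.im * (e k).re) / Complex.normSq v := by ring
    rw [h2]; positivity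
  have hmul : ∀ k, e k = e k / v * v := fun k => by field_simp
  have key : 0 ≤ cross (e i / v) (e j / v) := by
    have hsin : 0 ≤ Real.sin ((e j / v).arg - (e i / v).arg) := by
      apply Real.sin_nonneg_of_nonneg_of_le_pi
      · linarith [hi j]
      · linarith [Complex.arg_nonneg_iff.2 (him i), Complex.arg_le_pi (e j / v)]
    have : cross (e i / v) (e j / v)
        = ‖e i / v‖ * ‖e j / v‖ * Real.sin ((e j / v).arg - (e i / v).arg) := by
      rw [Real.sin_sub]
      simp only [cross]
      rw [← Complex.norm_mul_cos_arg (e i / v), ← Complex.norm_mul_sin_arg (e i / v),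
        ← Complex.norm_mul_cos_arg (e j / v), ← Complex.norm_mul_sin_arg (e j / v)]
      ring
    rw [this]; positivity
  have : cross (e i) (e j) = Complex.normSq v * cross (e i / v) (e j / v) := by
    conv_lhs => rw [hmul i, hmul j]
    simp only [cross, Complex.mul_re, Complex.mul_im, Complex.normSq_apply]
    ring
  rw [this]; positivity

/-- An unbounded set on which finitely many affine functions `cross (e i) · + b i` are positive
has a direction of recession. -/
theorem exists_recession {ι : Type*} {e : ι → ℂ} {b : ι → ℝ} {C : Set ℂ}
    (hC : ¬ Bornology.IsBounded C) (h : ∀ z ∈ C, ∀ i, 0 < cross (e i) z + b i) :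
    ∃ v : ℂ, v ≠ 0 ∧ ∀ i, 0 ≤ cross (e i) v := by
  have hz : ∀ k : ℕ, ∃ z ∈ C, (k : ℝ) < ‖z‖ := by
    intro k
    by_contra! hk
    exact hC (isBounded_iff_forall_norm_le.2 ⟨k, hk⟩)
  -- A limit of the normalized `z k` works: dividing the inequalities by `‖z k‖ → ∞` removes the
  -- constants `b i`.
  choose z hzC hzk using hz
  have hpos : ∀ k, 0 < ‖z k‖ := fun k => (Nat.cast_nonneg k).trans_lt (hzk k)
  have hsph : ∀ k, ((‖z k‖⁻¹ : ℝ) : ℂ) * z k ∈ Metric.sphere (0 : ℂ) 1 := fun k => by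
    simp [(hpos k).ne']
  obtain ⟨v, hv, φ, hφ, hlim⟩ := (isCompact_sphere (0 : ℂ) 1).tendsto_subseq hsph
  refine ⟨v, fun h0 => by simp [h0] at hv, fun i => ?_⟩
  have hinv : Tendsto (fun k => ‖z (φ k)‖⁻¹) atTop (𝓝 0) := by
    apply Tendsto.inv_tendsto_atTop
    apply Tendsto.comp (g := fun k => ‖z k‖) _ hφ.tendsto_atTop
    exact tendsto_atTop_mono (fun k => (hzk k).le) tendsto_natCast_atTop_atTop
  have hlim' : Tendsto (fun k => cross (e i) (((‖z (φ k)‖⁻¹ : ℝ) : ℂ) * z (φ k))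
      + ‖z (φ k)‖⁻¹ * b i) atTop (𝓝 (cross (e i) v + 0 * b i)) := by
    refine Tendsto.add ?_ (hinv.mul_const _)
    have hc : Continuous (cross (e i)) :=
      continuous_cross.comp (by fun_prop : Continuous fun w => (e i, w))
    exact (hc.tendsto v).comp hlim
  rw [zero_mul, add_zero] at hlim'
  refine ge_of_tendsto' hlim' fun k => ?_
  have h1 := h _ (hzC (φ k)) i
  have h2 : cross (e i) (((‖z (φ k)‖⁻¹ : ℝ) : ℂ) * z (φ k)) + ‖z (φ k)‖⁻¹ * b i
      = ‖z (φ k)‖⁻¹ * (cross (e i) (z (φ k)) + b i) := by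
    simp only [cross, Complex.re_ofReal_mul, Complex.im_ofReal_mul]; ring
  rw [h2]
  have := hpos (φ k)
  positivity

/-- A component containing `F` stays on the side of `F` of every line, so if unbounded it has a
recession direction `v`. Conversely, the ray from `F` along such a `v` never reaches a line. -/
theorem mem_unboundedRegion_iff_exists {ι : Type*} {P : ι → ℂ} {F : ℂ}
    (hP : ∀ i, P i ≠ F) (ε : ι → ℝ) :
    F ∈ unboundedRegion (fun i => lineOfRay (P i) F (ε i)) ↔
      (∀ i, Real.sin (ε i) ≠ 0) ∧
        ∃ v : ℂ, v ≠ 0 ∧ ∀ i, 0 ≤ cross v (Real.sin (ε i) * direction (P i) F (ε i)) := by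
  have hn : ∀ i, 0 < Complex.normSq (F - P i) := fun i =>
    Complex.normSq_pos.2 (sub_ne_zero.2 (hP i).symm)
  have hF : F ∈ (⋃ i, lineOfRay (P i) F (ε i))ᶜ ↔ ∀ i, Real.sin (ε i) ≠ 0 := by
    simp only [Set.mem_compl_iff, Set.mem_iUnion, not_exists]
    refine forall_congr' fun i => ?_
    rw [mem_lineOfRay_iff (hP i), cross_direction_sub, neg_eq_zero, mul_eq_zero]
    simp [(hn i).ne']
  have hsmul : ∀ (r : ℝ) (a b : ℂ), cross (r * a) b = r * cross a b := fun r a b => by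
    simp only [cross, Complex.re_ofReal_mul, Complex.im_ofReal_mul]; ring
  constructor
  · rintro ⟨C, ⟨x, hx, rfl, hb⟩, hFC⟩
    have hsub := connectedComponentIn_subset (⋃ i, lineOfRay (P i) F (ε i))ᶜ x
    have hs := hF.1 (hsub hFC)
    refine ⟨hs, ?_⟩
    have hpc : IsPreconnected (connectedComponentIn (⋃ i, lineOfRay (P i) F (ε i))ᶜ x) :=
      isPreconnected_connectedComponentIn
    obtain ⟨v, hv, h⟩ := exists_recession (e := fun i => -Real.sin (ε i) * direction (P i) F (ε i))
      (b := fun i => Real.sin (ε i) * cross (direction (P i) F (ε i)) (P i)) hb (by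
        intro z hz i
        set C := connectedComponentIn (⋃ i, lineOfRay (P i) F (ε i))ᶜ x
        -- `g` vanishes exactly on the `i`-th line and is positive at `F`, so it is positive on the
        -- whole connected set `C`.
        set g : ℂ → ℝ := fun w => -Real.sin (ε i) * cross (direction (P i) F (ε i)) (w - P i)
        have hg : Continuous g := by
          simp only [g, cross]; fun_prop
        have hg0 : ∀ w ∈ C, g w ≠ 0 := fun w hw h0 => by
          have h1 : cross (direction (P i) F (ε i)) (w - P i) = 0 := by
            simpa [g, hs i] using h0
          exact hsub hw (Set.mem_iUnion.2 ⟨i, (mem_lineOfRay_iff (hP i) _ _).2 h1⟩)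
        have hgF : 0 < g F := by
          simp only [g, cross_direction_sub]
          have := hn i
          have := hs i
          have h2 : -Real.sin (ε i) * -(Complex.normSq (F - P i) * Real.sin (ε i))
            = Complex.normSq (F - P i) * Real.sin (ε i) ^ 2 := by ring
          rw [h2]; positivity
        have hgz : 0 < g z := by
          by_contra! hle
          obtain ⟨w, hw, hw0⟩ := hpc.intermediate_value hz hFC hg.continuousOn
            (Set.mem_Icc.2 ⟨hle, hgF.le⟩)
          exact hg0 w hw hw0
        have h3 : cross (-Real.sin (ε i) * direction (P i) F (ε i)) z
          + Real.sin (ε i) * cross (direction (P i) F (ε i)) (P i) = g z := by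
          have := hsmul (-Real.sin (ε i)) (direction (P i) F (ε i)) z
          push_cast at this ⊢
          rw [this]
          simp only [g, cross, Complex.sub_re, Complex.sub_im]; ring
        rw [h3]; exact hgz)
    refine ⟨v, hv, fun i => ?_⟩
    have h4 := h i
    have h5 : cross (-Real.sin (ε i) * direction (P i) F (ε i)) v
        = cross v (Real.sin (ε i) * direction (P i) F (ε i)) := by
      rw [cross_swap v, neg_mul]
      simp only [cross, Complex.neg_re, Complex.neg_im]; ring
    rw [← h5]; exact h4
  · rintro ⟨hs, v, hv, h⟩
    refine ⟨_, ⟨F, hF.2 hs, rfl, ?_⟩, mem_connectedComponentIn (hF.2 hs)⟩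
    set R : Set ℂ := (fun t : ℝ => F + t * v) '' Set.Ici 0
    have hR : IsPreconnected R := isPreconnected_Ici.image _ (by fun_prop)
    have hFR : F ∈ R := ⟨0, by simp, by simp⟩
    have hRS : R ⊆ (⋃ i, lineOfRay (P i) F (ε i))ᶜ := by
      rintro _ ⟨t, ht, rfl⟩ hmem
      obtain ⟨i, hi⟩ := Set.mem_iUnion.1 hmem
      rw [mem_lineOfRay_iff (hP i)] at hi
      have h1 := cross_direction_sub (P i) F (ε i)
      have h2 := h i
      rw [cross_swap, hsmul] at h2
      have h3 : cross (direction (P i) F (ε i)) (F + t * v - P i)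
        = cross (direction (P i) F (ε i)) (F - P i) + t * cross (direction (P i) F (ε i)) v := by
        simp only [cross, Complex.sub_re, Complex.sub_im, Complex.add_re, Complex.add_im,
          Complex.re_ofReal_mul, Complex.im_ofReal_mul]; ring
      have h4 : 0 < Complex.normSq (F - P i) * Real.sin (ε i) ^ 2 := by
        have := hn i
        have := hs i
        positivity
      have h5 : 0 ≤ t * -(Real.sin (ε i) * cross (direction (P i) F (ε i)) v) :=
        mul_nonneg ht h2
      rw [h3, h1] at hi
      have h6 : Real.sin (ε i) * (-(Complex.normSq (F - P i) * Real.sin (ε i))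
        + t * cross (direction (P i) F (ε i)) v) = 0 := by rw [hi, mul_zero]
      nlinarith
    intro hb
    have hb' := hb.subset (hR.subset_connectedComponentIn hFR hRS)
    obtain ⟨c, hc⟩ := isBounded_iff_forall_norm_le.1 hb'
    have hvn : 0 < ‖v‖ := norm_pos_iff.2 hv
    -- This time makes the displacement from `F` as long as `|c| + ‖F‖ + 1`, too long for the bound
    -- `c`.
    have ht : 0 ≤ (|c| + ‖F‖ + 1) / ‖v‖ := by positivity
    have h1 := hc _ ⟨_, ht, rfl⟩
    have h2 : ‖(((|c| + ‖F‖ + 1) / ‖v‖ : ℝ) : ℂ) * v‖ = |c| + ‖F‖ + 1 := by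
      rw [norm_mul, Complex.norm_real, Real.norm_of_nonneg ht]
      field_simp
    have h3 := norm_sub_le (F + (((|c| + ‖F‖ + 1) / ‖v‖ : ℝ) : ℂ) * v) F
    rw [add_sub_cancel_left, h2] at h3
    linarith [le_abs_self c]

/-- The point `F` lies in an unbounded region iff it lies on none of the lines and, after
reorienting the lines so that `F` is on the same side of each, one of the directions comes first. -/
theorem mem_unboundedRegion_iff {ι : Type*} [Finite ι] [Nonempty ι] {P : ι → ℂ} {F : ℂ}
    (hP : ∀ i, P i ≠ F) (ε : ι → ℝ) :
    F ∈ unboundedRegion (fun i => lineOfRay (P i) F (ε i)) ↔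
      (∀ i, Real.sin (ε i) ≠ 0) ∧ ∃ i, ∀ j, 0 ≤ Real.sin (ε i) * Real.sin (ε j) *
        cross (direction (P i) F (ε i)) (direction (P j) F (ε j)) := by
  rw [mem_unboundedRegion_iff_exists hP]
  have hmul : ∀ i j, Real.sin (ε i) * Real.sin (ε j) *
        cross (direction (P i) F (ε i)) (direction (P j) F (ε j)) =
      cross (Real.sin (ε i) * direction (P i) F (ε i))
        (Real.sin (ε j) * direction (P j) F (ε j)) := fun i j => by
    simp only [cross, Complex.re_ofReal_mul, Complex.im_ofReal_mul]; ring
  simp only [hmul]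
  refine and_congr_right fun hs => ⟨?_, ?_⟩
  · rintro ⟨v, hv, h⟩
    exact exists_forall_cross_nonneg hv h
  · rintro ⟨i, hi⟩
    exact ⟨_, mul_ne_zero (Complex.ofReal_ne_zero.2 (hs i)) (direction_ne_zero (hP i) _), hi⟩

/-- The criterion is a finite combination of sign conditions on continuous functions of the angles.
-/
theorem measurableSet_mem_unboundedRegion {Ω ι : Type*} [MeasurableSpace Ω] [Finite ι]
    [Nonempty ι] {P : ι → ℂ} {F : ℂ} (hP : ∀ i, P i ≠ F) {ε : ι → Ω → ℝ}
    (hε : ∀ i, Measurable (ε i)) :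
    MeasurableSet {ω | F ∈ unboundedRegion fun i => lineOfRay (P i) F (ε i ω)} := by
  have : Countable ι := Finite.to_countable
  simp only [mem_unboundedRegion_iff hP, Set.ofPred_and, Set.ofPred_exists, Set.ofPred_forall]
  have hd : ∀ i, Measurable fun ω => direction (P i) F (ε i ω) := fun i =>
    (continuous_direction _ _).measurable.comp (hε i)
  have hs : ∀ i, Measurable fun ω => Real.sin (ε i ω) := fun i =>
    Real.measurable_sin.comp (hε i)
  refine (MeasurableSet.iInter fun i => ?_).inter
    (MeasurableSet.iUnion fun i => MeasurableSet.iInter fun j => ?_)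
  · exact (hs i (measurableSet_singleton 0)).compl
  · exact measurableSet_le measurable_const (((hs i).mul (hs j)).mul
      (continuous_cross.measurable.comp ((hd i).prodMk (hd j))))

end CockedHat

namespace CockedHat

/-! ### Geometry of two meeting rays. -/

theorem exists_sub_eq_of_mem_ray_inter {P Q F : ℂ} {x y : ℝ}
    (h : (ray P F x ∩ ray Q F y).Nonempty) :
    ∃ t u : ℝ, 0 < t ∧ 0 < u ∧ P - Q = u * direction Q F y - t * direction P F x := by
  obtain ⟨z, ⟨t, ht, rfl⟩, u, hu, h⟩ := h
  exact ⟨t, u, ht, hu, by linear_combination h⟩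

/-- If two rays meet, then the orientation of their directions can be read off from either one. -/
theorem sign_cross_of_ray_inter {P Q F : ℂ} {x y : ℝ} (h : (ray P F x ∩ ray Q F y).Nonempty) :
    SignType.sign (cross (direction P F x) (P - Q)) =
        SignType.sign (cross (direction P F x) (direction Q F y)) ∧
      SignType.sign (cross (direction Q F y) (P - Q)) =
        SignType.sign (cross (direction P F x) (direction Q F y)) := by
  obtain ⟨t, u, ht, hu, h⟩ := exists_sub_eq_of_mem_ray_inter h
  -- Crossing the relation for `P - Q` with either direction kills that direction's own term and
  -- leaves a positive multiple of the same cross product.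
  have h1 : cross (direction P F x) (P - Q) = u * cross (direction P F x) (direction Q F y) := by
    rw [h]
    simp only [cross, Complex.sub_re, Complex.sub_im, Complex.re_ofReal_mul,
      Complex.im_ofReal_mul]
    ring
  have h2 : cross (direction Q F y) (P - Q) = t * cross (direction P F x) (direction Q F y) := by
    rw [h]
    simp only [cross, Complex.sub_re, Complex.sub_im, Complex.re_ofReal_mul,
      Complex.im_ofReal_mul]
    ring
  rw [h1, h2, sign_mul, sign_mul, sign_pos ht, sign_pos hu, one_mul]
  exact ⟨rfl, rfl⟩

/-- The ray pointing away from `F` meets only rays on one side of the line from `Q` to `F`. -/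
theorem ray_pi_inter_eq_empty {P Q F : ℂ} {y : ℝ} (hκ : cross (P - Q) (F - P) ≠ 0)
    (hy : 0 ≤ cross (P - Q) (F - P) * Real.sin y) : ray P F Real.pi ∩ ray Q F y = ∅ := by
  rw [← Set.not_nonempty_iff_eq_empty]
  intro h
  obtain ⟨t, u, ht, hu, h⟩ := exists_sub_eq_of_mem_ray_inter h
  have h1 := cross_direction_sub Q F y
  have hd : u * direction Q F y = P - Q - t * (F - P) := by
    rw [h]; simp [direction]; ring
  -- A common point forces `sin y` to have the sign opposite to `cross (P - Q) (F - P)`.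
  have h2 : u * cross (direction Q F y) (F - Q) = (1 + t) * cross (P - Q) (F - P) := by
    have : u * cross (direction Q F y) (F - Q) = cross (u * direction Q F y) (F - Q) := by
      simp only [cross, Complex.re_ofReal_mul, Complex.im_ofReal_mul]; ring
    rw [this, hd]
    simp only [cross, Complex.sub_re, Complex.sub_im, Complex.re_ofReal_mul,
      Complex.im_ofReal_mul]
    ring
  rw [h1] at h2
  have h3 : 0 < cross (P - Q) (F - P) ^ 2 := by positivity
  have h4 : 0 ≤ u * Complex.normSq (F - Q) * (cross (P - Q) (F - P) * Real.sin y) :=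
    mul_nonneg (mul_nonneg hu.le (Complex.normSq_nonneg _)) hy
  have h5 : 0 < t * cross (P - Q) (F - P) ^ 2 := by positivity
  have h6 : u * -(Complex.normSq (F - Q) * Real.sin y) * cross (P - Q) (F - P)
    = (1 + t) * cross (P - Q) (F - P) * cross (P - Q) (F - P) := by rw [h2]
  nlinarith

/-- By `hx` the ray is turned from `F` away from the side of `Q`, so if it lies on the line `PQ` it
must point away from `Q`. -/
theorem exists_direction_eq_of_cross_eq_zero {P Q F : ℂ} {x : ℝ}
    (hκ : cross (Q - P) (F - P) ≠ 0) (hx : 0 ≤ cross (Q - P) (F - P) * Real.sin x)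
    (h : cross (direction P F x) (P - Q) = 0) : ∃ r : ℝ, r ≤ 0 ∧ direction P F x = r * (Q - P) := by
  have hQP : Q - P ≠ 0 := fun h0 => hκ (by simp [h0, cross])
  have h0 : cross (Q - P) (direction P F x) = 0 := by
    simp only [cross, Complex.sub_re, Complex.sub_im] at h ⊢
    linear_combination h
  obtain ⟨r, hr⟩ := exists_eq_mul_of_cross_eq_zero hQP h0
  refine ⟨r, ?_, hr⟩
  have h1 := cross_direction_sub P F x
  have h2 : cross (direction P F x) (F - P) = r * cross (Q - P) (F - P) := by
    rw [hr]
    simp only [cross, Complex.re_ofReal_mul, Complex.im_ofReal_mul]; ring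
  rw [h2] at h1
  have h3 : 0 < cross (Q - P) (F - P) ^ 2 := by positivity
  have h4 := mul_nonneg (Complex.normSq_nonneg (F - P)) hx
  by_contra! hr0
  have h5 := mul_pos hr0 h3
  have h6 : r * cross (Q - P) (F - P) ^ 2 =
      -(Complex.normSq (F - P) * (cross (Q - P) (F - P) * Real.sin x)) := by
    linear_combination cross (Q - P) (F - P) * h1
  linarith

/-- Two rays on the line `PQ` that both point away from the segment between their starting points
do not meet. -/
theorem ray_inter_eq_empty_of_direction_eq {P Q F : ℂ} {x y r s : ℝ} (hPQ : P ≠ Q) (hr : r ≤ 0)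
    (hs : s ≤ 0) (hx : direction P F x = r * (Q - P)) (hy : direction Q F y = s * (P - Q)) :
    ray P F x ∩ ray Q F y = ∅ := by
  rw [← Set.not_nonempty_iff_eq_empty]
  intro h
  obtain ⟨t, u, ht, hu, h⟩ := exists_sub_eq_of_mem_ray_inter h
  rw [hx, hy] at h
  have h1 : ((1 - u * s - t * r : ℝ) : ℂ) * (P - Q) = 0 := by
    push_cast; linear_combination h
  have h2 : 0 < 1 - u * s - t * r := by nlinarith
  rcases mul_eq_zero.1 h1 with h3 | h3
  · exact h2.ne' (Complex.ofReal_eq_zero.1 h3)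
  · exact hPQ (sub_eq_zero.1 h3)

/-! ### Independence and almost sure orientation. -/

section Probability

variable {Ω : Type*} [MeasurableSpace Ω] {μ : Measure Ω}

/-- Two independent variables with countably many values that agree almost surely are almost
surely constant. -/
theorem exists_ae_eq_const_of_indepFun_of_ae_eq [IsProbabilityMeasure μ] {β : Type*} [Countable β]
    [MeasurableSpace β] [MeasurableSingletonClass β] {X Y : Ω → β} (hX : Measurable X)
    (hind : IndepFun X Y μ) (hXY : X =ᵐ[μ] Y) : ∃ c, ∀ᵐ ω ∂μ, X ω = c := by
  by_contra hcon
  -- Being independent of itself, `X` takes each value with probability `0` or `1`; by countability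
  -- not all of these are `0`.
  have hself : IndepFun X X μ := hind.congr (ae_eq_refl X) hXY.symm
  have hzero : ∀ c, μ (X ⁻¹' {c}) = 0 := by
    intro c
    have hm := hX (measurableSet_singleton c)
    have h := hself.measure_inter_preimage_eq_mul {c} {c} (measurableSet_singleton c)
      (measurableSet_singleton c)
    rw [Set.inter_self] at h
    by_contra h0
    have h1 : μ (X ⁻¹' {c}) = 1 :=
      ((ENNReal.mul_eq_left h0 (measure_ne_top _ _)).1 h.symm)
    exact hcon ⟨c, (mem_ae_iff_prob_eq_one hm).2 h1⟩
  have huniv : μ Set.univ = 0 := by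
    have : (Set.univ : Set Ω) = ⋃ c, X ⁻¹' {c} := by ext ω; simp
    rw [this]
    exact measure_iUnion_null hzero
  simp at huniv

/-- This is how almost sure meeting constrains each angle separately: a product of two sets of
positive probability cannot consist of pairs with disjoint rays. -/
theorem measure_eq_zero_or_of_indepFun {X Y : Ω → ℝ}
    (hind : IndepFun X Y μ) {r : ℝ → ℝ → Prop} (h : μ {ω | r (X ω) (Y ω)} = 0) {B C : Set ℝ}
    (hB : MeasurableSet B) (hC : MeasurableSet C) (hBC : ∀ x ∈ B, ∀ y ∈ C, r x y) :
    μ (X ⁻¹' B) = 0 ∨ μ (Y ⁻¹' C) = 0 := by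
  rw [← mul_eq_zero, ← hind.measure_inter_preimage_eq_mul B C hB hC]
  exact measure_mono_null (fun ω hω => hBC _ hω.1 _ hω.2) h

theorem exists_measurableSet_sin_nonneg {X : Ω → ℝ}
    (hrange : ∀ ω, X ω ∈ Set.Ioc (-Real.pi) Real.pi) (hneg : μ {ω | X ω < 0} ≠ 0)
    (hpos : μ {ω | 0 < X ω} ≠ 0) (κ : ℝ) :
    ∃ B, MeasurableSet B ∧ μ (X ⁻¹' B) ≠ 0 ∧ ∀ x ∈ B, 0 ≤ κ * Real.sin x := by
  rcases le_total 0 κ with hκ | hκ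
  · refine ⟨Set.Ioc 0 Real.pi, measurableSet_Ioc, ?_, fun x hx =>
      mul_nonneg hκ (Real.sin_nonneg_of_nonneg_of_le_pi hx.1.le hx.2)⟩
    convert hpos using 2
    ext ω
    simp [(hrange ω).2]
  · refine ⟨Set.Ioo (-Real.pi) 0, measurableSet_Ioo, ?_, fun x hx =>
      mul_nonneg_of_nonpos_of_nonpos hκ (Real.sin_nonpos_of_nonpos_of_neg_pi_le hx.2.le hx.1.le)⟩
    convert hneg using 2
    ext ω
    have := (hrange ω).1
    simp [this]

/-- A ray pointing away from `F` misses the other ray whenever the latter is on a suitable side of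
`F`, which has positive probability. -/
theorem ae_ne_pi_of_ray_inter {P Q F : ℂ} (hκ : cross (P - Q) (F - P) ≠ 0) {X Y : Ω → ℝ}
    (hind : IndepFun X Y μ)
    (hrange : ∀ ω, Y ω ∈ Set.Ioc (-Real.pi) Real.pi) (hneg : μ {ω | Y ω < 0} ≠ 0)
    (hpos : μ {ω | 0 < Y ω} ≠ 0)
    (hinter : μ {ω | ray P F (X ω) ∩ ray Q F (Y ω) = ∅} = 0) : ∀ᵐ ω ∂μ, X ω ≠ Real.pi := by
  obtain ⟨C, hC, hC0, hCs⟩ :=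
    exists_measurableSet_sin_nonneg hrange hneg hpos (cross (P - Q) (F - P))
  have h := (measure_eq_zero_or_of_indepFun (r := fun x y => ray P F x ∩ ray Q F y = ∅) hind hinter
    (measurableSet_singleton Real.pi) hC (by
      rintro x rfl y hy
      exact ray_pi_inter_eq_empty hκ (hCs y hy))).resolve_right hC0
  rw [ae_iff]
  simpa [Set.preimage] using h

/-- If two independent rays, each leaving `F` on either side with positive probability, meet
almost surely, then the orientation of their directions is deterministic. -/
theorem ae_cross_direction_pos_or_neg [IsProbabilityMeasure μ] {P Q F : ℂ}
    (hκ : cross (Q - P) (F - P) ≠ 0) {X Y : Ω → ℝ}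
    (hX : Measurable X) (hind : IndepFun X Y μ)
    (hXrange : ∀ ω, X ω ∈ Set.Ioc (-Real.pi) Real.pi)
    (hYrange : ∀ ω, Y ω ∈ Set.Ioc (-Real.pi) Real.pi)
    (hXneg : μ {ω | X ω < 0} ≠ 0) (hXpos : μ {ω | 0 < X ω} ≠ 0)
    (hYneg : μ {ω | Y ω < 0} ≠ 0) (hYpos : μ {ω | 0 < Y ω} ≠ 0)
    (hinter : μ {ω | ray P F (X ω) ∩ ray Q F (Y ω) = ∅} = 0) :
    (∀ᵐ ω ∂μ, 0 < cross (direction P F (X ω)) (direction Q F (Y ω))) ∨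
      ∀ᵐ ω ∂μ, cross (direction P F (X ω)) (direction Q F (Y ω)) < 0 := by
  have hmeet : ∀ᵐ ω ∂μ, (ray P F (X ω) ∩ ray Q F (Y ω)).Nonempty := by
    rw [ae_iff]
    simpa only [Set.not_nonempty_iff_eq_empty] using hinter
  have hmc : ∀ R : ℂ, Measurable fun x : ℝ => cross (direction R F x) (P - Q) := fun R =>
    (continuous_cross.comp
      ((continuous_direction R F).prodMk (continuous_const (y := P - Q)))).measurable
  let _ : MeasurableSpace SignType := ⊤
  have : MeasurableSingletonClass SignType := ⟨fun _ => trivial⟩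
  have hms : Measurable (SignType.sign : ℝ → SignType) := by
    apply measurable_to_countable'
    intro c
    have h0 : MeasurableSet {x : ℝ | 0 < x} := measurableSet_lt measurable_const measurable_id
    have h1 : MeasurableSet {x : ℝ | x < 0} := measurableSet_lt measurable_id measurable_const
    cases c
    · convert measurableSet_singleton (0 : ℝ) using 1
      ext x
      exact sign_eq_zero_iff
    · convert h1 using 1
      ext x
      exact sign_eq_neg_one_iff
    · convert h0 using 1
      ext x
      exact sign_eq_one_iff
  -- The two signs depend on `X` alone and on `Y` alone, yet agree whenever the rays meet.
  obtain ⟨c, hc⟩ := exists_ae_eq_const_of_indepFun_of_ae_eq (hms.comp ((hmc P).comp hX))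
    (hind.comp (hms.comp (hmc P)) (hms.comp (hmc Q))) (by
      filter_upwards [hmeet] with ω hω
      have h := sign_cross_of_ray_inter hω
      exact h.1.trans h.2.symm)
  have hcP : ∀ᵐ ω ∂μ, SignType.sign (cross (direction P F (X ω)) (P - Q)) = c := hc
  have hcQ : ∀ᵐ ω ∂μ, SignType.sign (cross (direction Q F (Y ω)) (P - Q)) = c := by
    filter_upwards [hmeet, hcP] with ω hω h1
    have h := sign_cross_of_ray_inter hω
    rw [h.2, ← h.1, h1]
  have hcc : ∀ᵐ ω ∂μ, SignType.sign (cross (direction P F (X ω)) (direction Q F (Y ω))) = c := by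
    filter_upwards [hmeet, hcP] with ω hω h1
    rw [← (sign_cross_of_ray_inter hω).1, h1]
  cases c with
  | pos =>
    left
    filter_upwards [hcc] with ω h
    exact sign_eq_one_iff.1 h
  | neg =>
    right
    filter_upwards [hcc] with ω h
    exact sign_eq_neg_one_iff.1 h
  | zero =>
    -- Here both rays would almost surely lie on the line `PQ`. With positive probability both are
    -- turned away from the segment, and then they are disjoint.
    exfalso
    have hκ' : cross (P - Q) (F - Q) ≠ 0 := fun h0 => hκ (by
      simp only [cross, Complex.sub_re, Complex.sub_im] at h0 ⊢
      linear_combination -h0)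
    obtain ⟨B, hB, hB0, hBs⟩ := exists_measurableSet_sin_nonneg hXrange hXneg hXpos
      (cross (Q - P) (F - P))
    obtain ⟨C, hC, hC0, hCs⟩ := exists_measurableSet_sin_nonneg hYrange hYneg hYpos
      (cross (P - Q) (F - Q))
    have hPQ : P ≠ Q := fun h => hκ (by simp [h, cross])
    have key := measure_eq_zero_or_of_indepFun (r := fun x y => ray P F x ∩ ray Q F y = ∅)
      hind hinter
      (hB.inter ((hmc P) (measurableSet_singleton 0)))
      (hC.inter ((hmc Q) (measurableSet_singleton 0))) (by
        rintro x ⟨hx, hx0⟩ y ⟨hy, hy0⟩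
        obtain ⟨r, hr, hdr⟩ := exists_direction_eq_of_cross_eq_zero hκ (hBs x hx) hx0
        have hy0' : cross (direction Q F y) (Q - P) = 0 := by
          have h1 : cross (direction Q F y) (P - Q) = 0 := hy0
          simp only [cross, Complex.sub_re, Complex.sub_im] at h1 ⊢
          linear_combination -h1
        obtain ⟨s, hs, hds⟩ := exists_direction_eq_of_cross_eq_zero hκ' (hCs y hy) hy0'
        exact ray_inter_eq_empty_of_direction_eq hPQ hr hs hdr hds)
    rcases key with h | h
    · refine hB0 ?_
      rw [← h]
      refine measure_congr ?_
      filter_upwards [hcP] with ω hω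
      apply propext
      exact ⟨fun h => ⟨h, sign_eq_zero_iff.1 hω⟩, fun h => h.1⟩
    · refine hC0 ?_
      rw [← h]
      refine measure_congr ?_
      filter_upwards [hcQ] with ω hω
      apply propext
      exact ⟨fun h => ⟨h, sign_eq_zero_iff.1 hω⟩, fun h => h.1⟩

/-- Independent fair coins: every set of outcomes has the probability given by counting. -/
theorem measure_coins_mem {ι : Type*} [Fintype ι] [DecidableEq ι] {b : ι → Ω → Bool}
    (hb : ∀ i, Measurable (b i)) (hind : iIndepFun b μ)
    (hfair : ∀ i c, μ (b i ⁻¹' {c}) = 1 / 2) (T : Finset (ι → Bool)) :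
    μ {ω | (fun i => b i ω) ∈ T} = T.card * (1 / 2) ^ Fintype.card ι := by
  have hset : ∀ p : ι → Bool, {ω | (fun i => b i ω) = p} = ⋂ i ∈ Finset.univ, b i ⁻¹' {p i} := by
    intro p
    ext ω
    simp [funext_iff]
  have hone : ∀ p : ι → Bool, μ {ω | (fun i => b i ω) = p} = (1 / 2) ^ Fintype.card ι := by
    intro p
    rw [hset, hind.measure_inter_preimage_eq_mul Finset.univ
      (fun i _ => measurableSet_singleton (p i))]
    simp [hfair]
  have hU : {ω | (fun i => b i ω) ∈ T} = ⋃ p ∈ T, {ω | (fun i => b i ω) = p} := by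
    ext ω
    simp
  rw [hU, measure_biUnion_finset]
  · simp [hone]
  · intro p _ q _ hpq
    refine Set.disjoint_left.2 fun ω hp hq => hpq ?_
    exact (show (fun i => b i ω) = p from hp).symm.trans hq
  · intro p _
    rw [hset]
    exact Finset.measurableSet_biInter _ fun i _ => hb i (measurableSet_singleton _)

end Probability

/-! ### Counting the sign patterns. -/

open Classical in
/-- The outcomes of the signs, as Booleans, for which the `q.1`-th reoriented direction comes first
and has sign `q.2`, where `pos i j` says that the `j`-th direction is to the left of the `i`-th. -/
noncomputable def signPattern {ι : Type*} (pos : ι → ι → Prop) (q : ι × Bool) (j : ι) : Bool :=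
  if j = q.1 ∨ pos q.1 j then q.2 else !q.2

/-- For `i ≠ j` exactly one of `pos i j` and `pos j i` holds, so of the patterns led by `i` and by
`j` one has equal values at `i` and `j` and the other has opposite values. -/
theorem signPattern_injective {ι : Type*} {pos : ι → ι → Prop}
    (hpos : ∀ i j, i ≠ j → (pos i j ↔ ¬ pos j i)) : Function.Injective (signPattern pos) := by
  rintro ⟨i, s⟩ ⟨j, t⟩ h
  have hi := congrFun h i
  have hj := congrFun h j
  simp only [signPattern, true_or, if_true] at hi hj
  by_cases hij : i = j
  · subst hij
    simpa using hi
  · exfalso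
    have := hpos i j hij
    have hji : j ≠ i := Ne.symm hij
    by_cases h1 : pos i j <;> by_cases h2 : pos j i <;> simp_all

end CockedHat

open CockedHat

/-! ### The probability of an unbounded region. -/

theorem mainTheorem2 {Ω : Type*} [MeasurableSpace Ω]
    (μ : MeasureTheory.Measure Ω) [MeasureTheory.IsProbabilityMeasure μ]
    (n : ℕ) (hn : 3 ≤ n) (P : Fin n → ℂ) (F : ℂ)
    (hgen : CockedHat.GeneralPosition (Fin.cons F P : Fin (n + 1) → ℂ))
    (ε : Fin n → Ω → ℝ) (hmeas : ∀ i, Measurable (ε i))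
    (hrange : ∀ i ω, ε i ω ∈ Set.Ioc (-Real.pi) Real.pi)
    (hindep : ProbabilityTheory.iIndepFun ε μ)
    (hneg : ∀ i, μ {ω | ε i ω < 0} = 1 / 2)
    (hpos : ∀ i, μ {ω | 0 < ε i ω} = 1 / 2)
    (hinter : ∀ i j, i ≠ j →
      μ {ω | CockedHat.ray (P i) F (ε i ω) ∩ CockedHat.ray (P j) F (ε j ω) = ∅} = 0) :
    MeasurableSet
        {ω | F ∈ CockedHat.unboundedRegion fun i => CockedHat.lineOfRay (P i) F (ε i ω)} ∧
      μ {ω | F ∈ CockedHat.unboundedRegion fun i => CockedHat.lineOfRay (P i) F (ε i ω)} =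
        (2 * n) / 2 ^ n := by
  classical
  have : Nontrivial (Fin n) := Fin.nontrivial_iff_two_le.2 (by omega)
  have hκ : ∀ i j, i ≠ j → cross (P i - F) (P j - F) ≠ 0 := fun i j hij h0 => by
    have := hgen 0 i.succ j.succ (Fin.succ_ne_zero i).symm (Fin.succ_ne_zero j).symm
      (fun h => hij (Fin.succ_injective _ h))
    simp only [Fin.cons_zero, Fin.cons_succ] at this
    exact this (collinear_of_cross_eq_zero h0)
  have hP : ∀ i, P i ≠ F := fun i h => by
    obtain ⟨j, hj⟩ := exists_ne i
    exact hκ i j hj.symm (by simp [h, cross])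
  have hhalf : (1 / 2 : ENNReal) ≠ 0 := by simp
  have hneg0 : ∀ i, μ {ω | ε i ω < 0} ≠ 0 := fun i => by rw [hneg]; exact hhalf
  have hpos0 : ∀ i, μ {ω | 0 < ε i ω} ≠ 0 := fun i => by rw [hpos]; exact hhalf
  have hmpos : ∀ i, MeasurableSet {ω | 0 < ε i ω} := fun i =>
    measurableSet_lt measurable_const (hmeas i)
  have hmneg : ∀ i, MeasurableSet {ω | ε i ω < 0} := fun i =>
    measurableSet_lt (hmeas i) measurable_const
  refine ⟨measurableSet_mem_unboundedRegion hP hmeas, ?_⟩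
  have hne_zero : ∀ i, ∀ᵐ ω ∂μ, ε i ω ≠ 0 := fun i => by
    have h1 : μ ({ω | ε i ω < 0} ∪ {ω | 0 < ε i ω}) = 1 := by
      rw [measure_union _ (hmpos i), hneg, hpos, ENNReal.add_halves]
      exact Set.disjoint_left.2 fun ω h1 h2 => lt_asymm (show ε i ω < 0 from h1) h2
    filter_upwards [(mem_ae_iff_prob_eq_one ((hmneg i).union (hmpos i))).2 h1] with ω hω
    exact hω.elim (fun h => ne_of_lt h) (fun h => (ne_of_lt h).symm)
  have hne_pi : ∀ i, ∀ᵐ ω ∂μ, ε i ω ≠ Real.pi := fun i => by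
    obtain ⟨j, hj⟩ := exists_ne i
    refine ae_ne_pi_of_ray_inter (fun h0 => hκ i j hj.symm ?_) (hindep.indepFun hj.symm)
      (hrange j) (hneg0 j) (hpos0 j) (hinter i j hj.symm)
    simp only [cross, Complex.sub_re, Complex.sub_im] at h0 ⊢
    linear_combination -h0
  let X : Fin n → Fin n → Ω → ℝ := fun i j ω =>
    cross (direction (P i) F (ε i ω)) (direction (P j) F (ε j ω))
  have hXswap : ∀ i j ω, X i j ω = -X j i ω := fun i j ω => cross_swap _ _
  have hX : ∀ i j, i ≠ j → (∀ᵐ ω ∂μ, 0 < X i j ω) ∨ ∀ᵐ ω ∂μ, X i j ω < 0 := fun i j hij => by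
    refine ae_cross_direction_pos_or_neg (fun h0 => hκ i j hij ?_) (hmeas i)
      (hindep.indepFun hij) (hrange i) (hrange j) (hneg0 i) (hpos0 i) (hneg0 j) (hpos0 j)
      (hinter i j hij)
    simp only [cross, Complex.sub_re, Complex.sub_im] at h0 ⊢
    linear_combination h0
  -- A deterministic tournament: almost surely it records all pairwise orientations.
  let pos : Fin n → Fin n → Prop := fun i j => ∀ᵐ ω ∂μ, 0 < X i j ω
  have hnotpos : ∀ i j, i ≠ j → ¬ pos i j → ∀ᵐ ω ∂μ, X i j ω < 0 := fun i j hij h =>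
    (hX i j hij).resolve_left h
  have hanti : ∀ i j, i ≠ j → (pos i j ↔ ¬ pos j i) := fun i j hij => by
    constructor
    · intro h1 h2
      obtain ⟨ω, h3, h4⟩ := (h1.and h2).exists
      have := hXswap i j ω
      linarith
    · intro h
      filter_upwards [hnotpos j i hij.symm h] with ω hω
      have := hXswap i j ω
      linarith
  let b : Fin n → Ω → Bool := fun i ω => decide (0 < ε i ω)
  have hdec : Measurable fun x : ℝ => decide (0 < x) :=
    measurable_to_bool (by
      convert measurableSet_Ioi (a := (0 : ℝ)) using 1
      ext x
      simp)
  have hb : ∀ i, Measurable (b i) := fun i => hdec.comp (hmeas i)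
  have hfair : ∀ i c, μ (b i ⁻¹' {c}) = 1 / 2 := by
    intro i c
    have ht : μ (b i ⁻¹' {true}) = 1 / 2 := by
      rw [← hpos i]
      congr 1
      ext ω
      simp [b]
    cases c with
    | true => exact ht
    | false =>
      rw [← hneg i]
      refine measure_congr ?_
      filter_upwards [hne_zero i] with ω hω
      apply propext
      change decide (0 < ε i ω) = false ↔ ε i ω < 0
      rw [decide_eq_false_iff_not, not_lt]
      exact ⟨fun h => lt_of_le_of_ne h hω, le_of_lt⟩
  have hae : {ω | F ∈ unboundedRegion fun i => lineOfRay (P i) F (ε i ω)} =ᵐ[μ]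
      {ω | (fun i => b i ω) ∈ Finset.univ.image (signPattern pos)} := by
    have hsgn : ∀ᵐ ω ∂μ, ∀ i j, i ≠ j → (pos i j → 0 < X i j ω) ∧ (¬ pos i j → X i j ω < 0) := by
      simp only [ae_all_iff]
      intro i j hij
      by_cases h : pos i j
      · filter_upwards [h] with ω hω
        exact ⟨fun _ => hω, fun h' => absurd h h'⟩
      · filter_upwards [hnotpos i j hij h] with ω hω
        exact ⟨fun h' => absurd h' h, fun _ => hω⟩
    filter_upwards [hsgn, ae_all_iff.2 hne_zero, ae_all_iff.2 hne_pi] with ω hX0 h0 hpi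
    apply propext
    change F ∈ unboundedRegion (fun i => lineOfRay (P i) F (ε i ω)) ↔
      (fun i => b i ω) ∈ Finset.univ.image (signPattern pos)
    have hsin : ∀ i, (b i ω = true ∧ 0 < Real.sin (ε i ω)) ∨
        (b i ω = false ∧ Real.sin (ε i ω) < 0) := by
      intro i
      rcases lt_or_gt_of_ne (h0 i) with h | h
      · exact Or.inr ⟨by simpa [b] using h.le, Real.sin_neg_of_neg_of_neg_pi_lt h (hrange i ω).1⟩
      · exact Or.inl ⟨by simpa [b] using h,
          Real.sin_pos_of_pos_of_lt_pi h (lt_of_le_of_ne (hrange i ω).2 (hpi i))⟩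
    have hsin0 : ∀ i, Real.sin (ε i ω) ≠ 0 := fun i =>
      (hsin i).elim (fun h => h.2.ne') (fun h => h.2.ne)
    have hsame : ∀ i j, (0 < Real.sin (ε i ω) * Real.sin (ε j ω) ∧ b j ω = b i ω) ∨
        (Real.sin (ε i ω) * Real.sin (ε j ω) < 0 ∧ b j ω = !b i ω) := by
      intro i j
      rcases hsin i with ⟨hi, hi'⟩ | ⟨hi, hi'⟩ <;> rcases hsin j with ⟨hj, hj'⟩ | ⟨hj, hj'⟩ <;>
        rw [hi, hj]
      · exact Or.inl ⟨mul_pos hi' hj', rfl⟩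
      · exact Or.inr ⟨mul_neg_of_pos_of_neg hi' hj', rfl⟩
      · exact Or.inr ⟨mul_neg_of_neg_of_pos hi' hj', rfl⟩
      · exact Or.inl ⟨mul_pos_of_neg_of_neg hi' hj', rfl⟩
    -- As the sign of `X i j` is fixed by `pos`, the inequality says that the signs of `ε i` and `ε
    -- j` agree when `pos i j` holds and differ otherwise; for `j = i` it is trivial.
    have hentry : ∀ i j, 0 ≤ Real.sin (ε i ω) * Real.sin (ε j ω) * X i j ω ↔
        signPattern pos (i, b i ω) j = b j ω := by
      intro i j
      by_cases hij : j = i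
      · subst hij
        simp [signPattern, X, cross_self]
      · have hij' : i ≠ j := fun h => hij h.symm
        have hX1 := hX0 i j hij'
        by_cases hp : pos i j
        · have hx := hX1.1 hp
          rcases hsame i j with ⟨h1, h2⟩ | ⟨h1, h2⟩
          · simp [signPattern, hp, h2, (mul_pos h1 hx).le]
          · simp [signPattern, hp, h2, mul_neg_of_neg_of_pos h1 hx]
        · have hx := hX1.2 hp
          rcases hsame i j with ⟨h1, h2⟩ | ⟨h1, h2⟩
          · simp [signPattern, hp, hij, h2, mul_neg_of_pos_of_neg h1 hx]
          · simp [signPattern, hp, hij, h2, (mul_pos_of_neg_of_neg h1 hx).le]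
    rw [mem_unboundedRegion_iff hP]
    simp only [Finset.mem_image, Finset.mem_univ, true_and]
    constructor
    · rintro ⟨-, i, hi⟩
      exact ⟨(i, b i ω), funext fun j => (hentry i j).1 (hi j)⟩
    · rintro ⟨⟨i, c⟩, hc⟩
      refine ⟨hsin0, i, fun j => (hentry i j).2 ?_⟩
      -- A pattern shows its own sign at its leading index.
      have hci : c = b i ω := by simpa [signPattern] using congrFun hc i
      rw [← hci]
      exact congrFun hc j
  rw [measure_congr hae, measure_coins_mem hb (hindep.comp _ fun _ => hdec) hfair,
    Finset.card_image_of_injective _ (signPattern_injective hanti), Finset.card_univ,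
    Fintype.card_prod, Fintype.card_fin, Fintype.card_bool, one_div, ← ENNReal.inv_pow,
    ← div_eq_mul_inv]
  push_cast
  rw [mul_comm]
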